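/- Let $X$ be a topological space. A function system on $X$ is a finite non-empty family $\mathcal F$ of continuous maps $X\to X$. Let $\mathbb K(X)$ be the set of non-empty compact subsets of $X$ with the Vietoris topology, and for $K\in\mathbb K(X)$ put $\mathcal F(K)=\bigcup_{f\in\mathcal F}f(K)$. A set $A\in\mathbb K(X)$ is an attractor of $\mathcal F$ if $\mathcal F(A)=A$ and, for every $K\in\mathbb K(X)$, the iterates $\mathcal F^n(K)$ converge to $A$ in $\mathbb K(X)$; in a Hausdorff space there is at most one attractor. A function system $\mathcal F$ on a Hausdorff space $X$ is topologically contracting if (i) for every $K\in\mathbb K(X)$ there is $D\in\mathbb K(X)$ with $K\subset D$ and $\mathcal F(D)\subset D$, and (ii) for every $D\in\mathbb K(X)$ with $\mathcal F(D)\subset D$ and every sequence $(f_n)_{n\ge 0}$ of elements of $\mathcal F$, the set $\bigcap_{n\ge 0}f_0\circ\dots\circ f_n(D)$ is a singleton. A topological fractal is a non-empty compact Hausdorff space $K$ such that $K=\bigcup_{f\in\mathcal F}f(K)$ for some topologically contracting function system $\mathcal F$ on $K$. A self-map $f$ of a metric space $(X,d)$ is Rakotch contracting if there is a function $\varphi:[0,\infty)\to[0,\infty)$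 such that $d(f(x),f(x'))\le\varphi(d(x,x'))$ for all $x,x'\in X$ and $\sup_{a<t<\infty}\varphi(t)/t<1$ for every $a>0$. Theorem. Let $X$ be a Tychonoff space such that every compact metrizable space admits a topological embedding into $X$. Then every topological fractal is homeomorphic to the attractor of some topologically contracting function system $\mathcal F$ on $X$. If moreover $X$ is metrizable, then $\mathcal F$ can be chosen so that, in addition, all maps $f\in\mathcal F$ are Rakotch contracting with respect to some bounded metric $d$ generating the topology of $X$. -/

import Mathlib

open Set Filter Topology TopologicalSpace
open scoped NNReal

/-- A function system on `X`: a finite (nonempty) family of continuous self-maps of `X`. -/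
structure FunctionSystem (X : Type*) [TopologicalSpace X] where
  maps : Set C(X, X)
  finite : maps.Finite
  nonempty : maps.Nonempty

namespace FunctionSystem

/-- The map `K ↦ ⋃ f ∈ F, f(K)` on the hyperspace of nonempty compact subsets of `X`. -/
def hutchinson {X : Type*} [TopologicalSpace X] (F : FunctionSystem X)
    (K : NonemptyCompacts X) : NonemptyCompacts X where
  carrier := ⋃ f ∈ F.maps, f '' (K : Set X)
  isCompact' := F.finite.isCompact_biUnion fun f _ => K.isCompact.image f.continuous
  nonempty' := by
    obtain ⟨f, hf⟩ := F.nonempty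
    obtain ⟨x, hx⟩ := K.nonempty
    exact ⟨f x, mem_biUnion hf ⟨x, hx, rfl⟩⟩

/-- `A` is an attractor of `F`: it is a fixed point of the induced map on the hyperspace, and
the iterates of every nonempty compact set converge to `A` in the Vietoris topology. -/
def IsAttractor {X : Type*} [TopologicalSpace X] (F : FunctionSystem X)
    (A : NonemptyCompacts X) : Prop :=
  F.hutchinson A = A ∧
    ∀ K : NonemptyCompacts X, Tendsto (fun n : ℕ => F.hutchinson^[n] K) atTop (𝓝 A)

/-- The composition `f 0 ∘ f 1 ∘ ⋯ ∘ f n`. -/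
def compSeq {X : Type*} [TopologicalSpace X] (f : ℕ → C(X, X)) : ℕ → C(X, X)
  | 0 => f 0
  | n + 1 => (compSeq f n).comp (f (n + 1))

/-- Topologically contracting function systems. -/
def TopologicallyContracting {X : Type*} [TopologicalSpace X] (F : FunctionSystem X) : Prop :=
  (∀ K : NonemptyCompacts X, ∃ D : NonemptyCompacts X,
      (K : Set X) ⊆ D ∧ (F.hutchinson D : Set X) ⊆ D) ∧
    ∀ D : NonemptyCompacts X, (F.hutchinson D : Set X) ⊆ D →
      ∀ f : ℕ → C(X, X), (∀ n, f n ∈ F.maps) →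
        ∃ x : X, ⋂ n : ℕ, compSeq f n '' (D : Set X) = {x}

end FunctionSystem

/-- Topological fractals: nonempty compact Hausdorff spaces `K` such that
`K = ⋃ f ∈ F, f(K)` for some topologically contracting function system `F` on `K`. -/
structure IsTopologicalFractal (K : Type*) [TopologicalSpace K] : Prop where
  nonempty : Nonempty K
  compact : CompactSpace K
  hausdorff : T2Space K
  exists_system : ∃ F : FunctionSystem K,
    F.TopologicallyContracting ∧ ⋃ f ∈ F.maps, range f = univ

/-- Every compact metrizable space embeds into `X`. Every compact metrizable space, in any
universe, is homeomorphic to a subspace of the Hilbert cube, hence to a space in `Type`, so it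
is enough to quantify over `Type`. -/
def TopologicallyUniversal (X : Type*) [TopologicalSpace X] : Prop :=
  ∀ (K : Type) [TopologicalSpace K] [CompactSpace K] [MetrizableSpace K],
    ∃ e : K → X, IsEmbedding e

/-- `f` is `φ`-contracting. -/
def PhiContracting {X Y : Type*} [MetricSpace X] [MetricSpace Y] (φ : ℝ≥0 → ℝ≥0)
    (f : X → Y) : Prop :=
  ∀ x x' : X, nndist (f x) (f x') ≤ φ (nndist x x')

/-- `f` is Rakotch contracting: it is `φ`-contracting for some `φ` such that
`sup_{a < t < ∞} φ(t) / t < 1` for every `a > 0`. -/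
def RakotchContracting {X Y : Type*} [MetricSpace X] [MetricSpace Y] (f : X → Y) : Prop :=
  ∃ φ : ℝ≥0 → ℝ≥0, PhiContracting φ f ∧
    ∀ a : ℝ≥0, 0 < a → ∃ c : ℝ≥0, c < 1 ∧ ∀ t : ℝ≥0, a < t → φ t / t ≤ c

/-- All maps of `F` are Rakotch contracting with respect to some bounded metric on `X`
that generates the topology of `X`. -/
def FunctionSystem.RakotchMetrizable {X : Type*} [T : TopologicalSpace X]
    (F : FunctionSystem X) : Prop :=
  ∃ m : MetricSpace X,
    m.toUniformSpace.toTopologicalSpace = T ∧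
    (∃ C : ℝ, ∀ x y : X, m.dist x y ≤ C) ∧
    ∀ f ∈ F.maps, @RakotchContracting X X m m f

/-! Let `K` be a topological fractal. A compactness argument on the space of codes shows that long
compositions of the maps have uniformly small images, so `K` is metrizable. A weighted supremum over
all compositions then remetrizes `K` so that, at distances at least any `a > 0`, all maps contract
by a common factor below 1 (`exists_wordDist_contraction`). An infimum of affine functions packs
these factors into one subadditive modulus `φ` (`exists_isRakotchModulus`).

Subadditivity permits a McShane extension. The embedding `k ↦ dist k` puts `K` isometrically into
the compact set `lipFuns K`, and each `f` extends to a map of all bounded continuous functions into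
`lipFuns K` with the same modulus `φ`. By universality `lipFuns K` embeds into `X` by some `e`, with
image `E`; Tietze extension gives a bounded continuous `ρ` on `X` with `ρ ∘ e` the inclusion. The
required system consists of the maps `e ∘ mcShaneExt f ∘ ρ`.

These maps `φ`-contract the pseudometric pulled back along `ρ` and take values in the compact set
`E`, on which `ρ` is injective. That suffices for topological contraction and for Vietoris
convergence. If `X` is metrizable, some bounded compatible metric dominates the pseudometric and
equals it on `E`, so the same maps are Rakotch contracting. -/

open scoped BoundedContinuousFunction

/-! ### Compositions of the maps, and metrizability of topological fractals. -/

namespace FunctionSystem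

section Words

variable {X : Type*} [TopologicalSpace X]

/-- The `n`-fold compositions of maps of `F`. -/
def words (F : FunctionSystem X) : ℕ → Set C(X, X)
  | 0 => {ContinuousMap.id X}
  | n + 1 => image2 ContinuousMap.comp (F.words n) F.maps

theorem words_finite (F : FunctionSystem X) (n : ℕ) : (F.words n).Finite := by
  induction n with
  | zero => exact finite_singleton _
  | succ n ih => exact ih.image2 _ F.finite

theorem comp_mem_words {F : FunctionSystem X} {n : ℕ} {g f : C(X, X)} (hg : g ∈ F.words n)
    (hf : f ∈ F.maps) : g.comp f ∈ F.words (n + 1) :=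
  mem_image2_of_mem hg hf

theorem exists_mem_range_of_mem_words {F : FunctionSystem X}
    (hF : ⋃ f ∈ F.maps, range f = univ) (n : ℕ) (x : X) : ∃ g ∈ F.words n, x ∈ range g := by
  induction n with
  | zero => exact ⟨_, rfl, x, rfl⟩
  | succ n ih =>
    obtain ⟨g, hg, y, rfl⟩ := ih
    have hy : y ∈ ⋃ f ∈ F.maps, range f := hF ▸ mem_univ y
    simp only [mem_iUnion] at hy
    obtain ⟨f, hf, z, rfl⟩ := hy
    exact ⟨_, comp_mem_words hg hf, z, rfl⟩

theorem compSeq_congr {σ τ : ℕ → C(X, X)} {n : ℕ} (h : ∀ i ≤ n, σ i = τ i) :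
    compSeq σ n = compSeq τ n := by
  induction n with
  | zero => exact h 0 le_rfl
  | succ n ih => rw [compSeq, compSeq, ih fun i hi => h i (by omega), h (n + 1) le_rfl]

theorem exists_compSeq_of_mem_words {F : FunctionSystem X} {n : ℕ} {g : C(X, X)}
    (hg : g ∈ F.words (n + 1)) : ∃ σ : ℕ → F.maps, compSeq (fun i => (σ i : C(X, X))) n = g := by
  induction n generalizing g with
  | zero =>
    obtain ⟨a, rfl, f, hf, rfl⟩ := hg
    exact ⟨fun _ => ⟨f, hf⟩, rfl⟩
  | succ n ih =>
    obtain ⟨a, ha, f, hf, rfl⟩ := hg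
    obtain ⟨σ, rfl⟩ := ih ha
    refine ⟨Function.update σ (n + 1) ⟨f, hf⟩, ?_⟩
    rw [compSeq, compSeq_congr (τ := fun i => (σ i : C(X, X)))]
    · simp
    · intro i hi
      rw [Function.update_of_ne (by omega)]

theorem range_compSeq_antitone (σ : ℕ → C(X, X)) : Antitone fun n => range (compSeq σ n) := by
  refine antitone_nat_of_succ_le fun n => ?_
  rintro _ ⟨x, rfl⟩
  exact ⟨σ (n + 1) x, rfl⟩

/-- In a compact space, the images of long compositions are subordinate to any open cover. -/
theorem exists_forall_words_range_subset [CompactSpace X] [T2Space X] {F : FunctionSystem X}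
    (hF : ∀ σ : ℕ → C(X, X), (∀ n, σ n ∈ F.maps) → ∃ x, ⋂ n, range (compSeq σ n) = {x})
    {ι : Type*} {U : ι → Set X} (hU : ∀ i, IsOpen (U i)) (hcov : ∀ x, ∃ i, x ∈ U i) :
    ∃ N, ∀ n ≥ N, ∀ g ∈ F.words n, ∃ i, range g ⊆ U i := by
  -- König's lemma: `C n` collects the codes whose `n`-th image lies in no member of the cover. The
  -- code space is compact because `F.maps` is finite and discrete, so if no `N` works, some code
  -- lies in every `C n`. Its images shrink to a point, hence eventually into a member.
  let C : ℕ → Set (ℕ → F.maps) := fun n =>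
    {σ | ∀ i, ¬ range (compSeq (fun k => (σ k : C(X, X))) n) ⊆ U i}
  have : Finite F.maps := F.finite
  have hlc : ∀ n, IsLocallyConstant fun σ : ℕ → F.maps =>
      compSeq (fun k => (σ k : C(X, X))) n := by
    have h1 : ∀ k, IsLocallyConstant fun σ : ℕ → F.maps => (σ k : C(X, X)) := fun k =>
      ((IsLocallyConstant.of_discrete (id : F.maps → F.maps)).comp_continuous
        (continuous_apply k)).comp Subtype.val
    intro n
    induction n with
    | zero => exact h1 0
    | succ n ih => exact ih.comp₂ (h1 (n + 1)) ContinuousMap.comp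
  have hclosed : ∀ n, IsClosed (C n) := fun n =>
    isOpen_compl_iff.1 (hlc n {h | ∀ i, ¬ range h ⊆ U i}ᶜ)
  by_contra! hcon
  have hanti : Antitone C := fun m n hmn σ hσ i hi =>
    hσ i ((range_compSeq_antitone _ hmn).trans hi)
  have hne : ∀ n, (C n).Nonempty := by
    intro n
    obtain ⟨m, hm, g, hg, hgU⟩ := hcon (n + 1)
    -- `compSeq σ n` composes `n + 1` maps, so words of length `n + m + 1` correspond to index `n +
    -- m`.
    obtain ⟨m, rfl⟩ := Nat.exists_eq_add_of_lt (Nat.lt_of_succ_le hm)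
    obtain ⟨σ, hσ⟩ := exists_compSeq_of_mem_words hg
    exact ⟨σ, hanti (Nat.le_add_right n m) fun i => by rw [hσ]; exact hgU i⟩
  obtain ⟨σ, hσ⟩ := IsCompact.nonempty_iInter_of_sequence_nonempty_isCompact_isClosed C
    (fun n => hanti n.le_succ) hne (hclosed 0).isCompact hclosed
  obtain ⟨x, hx⟩ := hF (fun k => σ k) fun k => (σ k).2
  obtain ⟨i, hi⟩ := hcov x
  obtain ⟨n, hn⟩ := exists_subset_nhds_of_isCompact
    (V := fun n => range (compSeq (fun k => (σ k : C(X, X))) n))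
    (range_compSeq_antitone _).directed_ge
    (fun n => isCompact_range (ContinuousMap.continuous _)) (U := U i) (by
      intro y hy
      rw [hx] at hy
      rw [mem_singleton_iff.1 hy]
      exact (hU i).mem_nhds hi)
  exact mem_iInter.1 hσ n i hn

/-- Complements of finite unions of word images form a countable basis. For `x ∈ U`, the cover by
`U` and `{x}ᶜ` gives a level at which each image lies in `U` or misses `x`; deleting the images that
miss `x` leaves a neighbourhood of `x` inside `U`, since the images of that level cover `X`. -/
theorem metrizableSpace_of_contracting [CompactSpace X] [T2Space X] {F : FunctionSystem X}
    (hF : ∀ σ : ℕ → C(X, X), (∀ n, σ n ∈ F.maps) → ∃ x, ⋂ n, range (compSeq σ n) = {x})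
    (hcov : ⋃ f ∈ F.maps, range f = univ) : MetrizableSpace X := by
  let B : Set (Set X) := (fun T : Set C(X, X) => (⋃ g ∈ T, range g)ᶜ) ''
    {T | T.Finite ∧ T ⊆ ⋃ n, F.words n}
  have hBc : B.Countable := (Set.countable_ofPred_finite_subset
    (countable_iUnion fun n => (F.words_finite n).countable)).image _
  have hB : IsTopologicalBasis B := by
    refine isTopologicalBasis_of_isOpen_of_nhds ?_ ?_
    · rintro _ ⟨T, ⟨hT, -⟩, rfl⟩
      exact (hT.isCompact_biUnion fun g _ => isCompact_range g.continuous).isClosed.isOpen_compl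
    · intro x U hx hU
      obtain ⟨N, hN⟩ := exists_forall_words_range_subset hF (U := fun b : Bool => cond b U {x}ᶜ)
        (by rintro (_ | _); exacts [isOpen_compl_singleton, hU])
        (fun y => by
          by_cases h : y = x
          · exact ⟨true, h ▸ hx⟩
          · exact ⟨false, h⟩)
      refine ⟨_, ⟨{g ∈ F.words N | x ∉ range g}, ⟨(F.words_finite N).subset (sep_subset _ _),
        fun g hg => mem_iUnion.2 ⟨N, hg.1⟩⟩, rfl⟩, ?_, ?_⟩
      · simp only [mem_compl_iff, mem_iUnion, not_exists]
        exact fun g hg => hg.2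
      · intro y hy
        obtain ⟨g, hg, hgy⟩ := exists_mem_range_of_mem_words hcov N y
        obtain ⟨b, hb⟩ := hN N le_rfl g hg
        cases b with
        | true => exact hb hgy
        | false =>
          refine absurd ?_ hy
          simp only [mem_iUnion]
          exact ⟨g, ⟨hg, fun h => hb h rfl⟩, hgy⟩
  have := hB.secondCountableTopology hBc
  infer_instance

end Words

end FunctionSystem

/-! ### A contracting metric on a topological fractal. -/

namespace FunctionSystem

section WordDist

variable {X : Type*} [MetricSpace X]

/-- A weighted supremum of the distances between the images of two points under words in `F`. -/
noncomputable def wordDist (F : FunctionSystem X) (x y : X) : ℝ :=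
  ⨆ i : Σ n, F.words n, (2 - (1 / 2) ^ i.1) * dist (i.2.1 x) (i.2.1 y)

theorem one_le_weight (n : ℕ) : (1 : ℝ) ≤ 2 - (1 / 2) ^ n := by
  have : (1 / 2 : ℝ) ^ n ≤ 1 := pow_le_one₀ (by norm_num) (by norm_num)
  linarith

theorem weight_le_two (n : ℕ) : (2 : ℝ) - (1 / 2) ^ n ≤ 2 := by
  have : (0 : ℝ) ≤ (1 / 2 : ℝ) ^ n := by positivity
  linarith

theorem wordDist_le {F : FunctionSystem X} {x y : X} {r : ℝ}
    (h : ∀ n, ∀ g ∈ F.words n, (2 - (1 / 2 : ℝ) ^ n) * dist (g x) (g y) ≤ r) :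
    F.wordDist x y ≤ r := by
  have : Nonempty (Σ n, F.words n) := ⟨⟨0, _, rfl⟩⟩
  exact ciSup_le fun i => h i.1 i.2.1 i.2.2

theorem wordDist_comm (F : FunctionSystem X) (x y : X) : F.wordDist x y = F.wordDist y x := by
  simp only [wordDist, dist_comm]

variable [CompactSpace X]

theorem bddAbove_wordDist (F : FunctionSystem X) (x y : X) :
    BddAbove (range fun i : Σ n, F.words n =>
      (2 - (1 / 2 : ℝ) ^ i.1) * dist (i.2.1 x) (i.2.1 y)) := by
  refine ⟨2 * Metric.diam (univ : Set X), ?_⟩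
  rintro _ ⟨i, rfl⟩
  exact mul_le_mul (weight_le_two _) (Metric.dist_le_diam_of_mem isCompact_univ.isBounded
    (mem_univ _) (mem_univ _)) dist_nonneg zero_le_two

theorem le_wordDist {F : FunctionSystem X} {n : ℕ} {g : C(X, X)} (hg : g ∈ F.words n) (x y : X) :
    (2 - (1 / 2 : ℝ) ^ n) * dist (g x) (g y) ≤ F.wordDist x y :=
  le_ciSup (F.bddAbove_wordDist x y) ⟨n, g, hg⟩

theorem dist_le_wordDist (F : FunctionSystem X) (x y : X) : dist x y ≤ F.wordDist x y := by
  simpa using (mul_le_mul_of_nonneg_right (one_le_weight 0) dist_nonneg).trans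
    (le_wordDist (F := F) (n := 0) (g := ContinuousMap.id X) rfl x y)

theorem wordDist_self (F : FunctionSystem X) (x : X) : F.wordDist x x = 0 :=
  le_antisymm (wordDist_le fun n g _ => by simp)
    (dist_nonneg.trans (dist_le_wordDist F x x))

theorem wordDist_triangle (F : FunctionSystem X) (x y z : X) :
    F.wordDist x z ≤ F.wordDist x y + F.wordDist y z := by
  refine wordDist_le fun n g hg => ?_
  calc _ ≤ (2 - (1 / 2 : ℝ) ^ n) * (dist (g x) (g y) + dist (g y) (g z)) :=
        mul_le_mul_of_nonneg_left (dist_triangle _ _ _) (zero_le_one.trans (one_le_weight n))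
    _ ≤ _ := by
      rw [mul_add]
      exact add_le_add (le_wordDist hg x y) (le_wordDist hg y z)

theorem exists_forall_words_dist_lt {F : FunctionSystem X}
    (hF : ∀ σ : ℕ → C(X, X), (∀ n, σ n ∈ F.maps) → ∃ x, ⋂ n, range (compSeq σ n) = {x})
    {ε : ℝ} (hε : 0 < ε) :
    ∃ N, ∀ n ≥ N, ∀ g ∈ F.words n, ∀ x y, dist (g x) (g y) < ε := by
  obtain ⟨N, hN⟩ := exists_forall_words_range_subset hF
    (U := fun x : X => Metric.ball x (ε / 2)) (fun _ => Metric.isOpen_ball)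
    (fun x => ⟨x, Metric.mem_ball_self (half_pos hε)⟩)
  refine ⟨N, fun n hn g hg x y => ?_⟩
  obtain ⟨z, hz⟩ := hN n hn g hg
  have h1 := hz (mem_range_self x)
  have h2 := hz (mem_range_self y)
  rw [Metric.mem_ball] at h1 h2
  linarith [dist_triangle_right (g x) (g y) z]

/-- Long words move all pairs uniformly close, so only finitely many continuous words matter near a
given point. -/
theorem isOpen_iff_wordDist {F : FunctionSystem X}
    (hF : ∀ σ : ℕ → C(X, X), (∀ n, σ n ∈ F.maps) → ∃ x, ⋂ n, range (compSeq σ n) = {x})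
    (s : Set X) : IsOpen s ↔ ∀ x ∈ s, ∃ ε > 0, ∀ y, F.wordDist x y < ε → y ∈ s := by
  constructor
  · intro hs x hx
    obtain ⟨ε, hε, h⟩ := Metric.isOpen_iff.1 hs x hx
    exact ⟨ε, hε, fun y hy => h (by
      rw [Metric.mem_ball, dist_comm]; exact (F.dist_le_wordDist x y).trans_lt hy)⟩
  · intro h
    rw [isOpen_iff_mem_nhds]
    intro x hx
    obtain ⟨ε, hε, hy⟩ := h x hx
    obtain ⟨N, hN⟩ := exists_forall_words_dist_lt hF (show 0 < ε / 4 by linarith)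
    have hev : ∀ᶠ y in 𝓝 x, ∀ n ∈ Finset.range N, ∀ g ∈ F.words n, dist (g x) (g y) < ε / 4 := by
      rw [Filter.eventually_all_finset]
      intro n _
      rw [Filter.eventually_all_finite (F.words_finite n)]
      intro g _
      have : Tendsto (fun y => dist (g x) (g y)) (𝓝 x) (𝓝 (dist (g x) (g x))) :=
        (continuous_const.dist g.continuous).tendsto x
      rw [dist_self] at this
      exact this.eventually_lt_const (by linarith)
    filter_upwards [hev] with y hxy
    refine hy y (lt_of_le_of_lt (b := ε / 2) (wordDist_le fun n g hg => ?_) (by linarith))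
    have hd : dist (g x) (g y) < ε / 4 := by
      rcases lt_or_ge n N with hn | hn
      · exact hxy n (Finset.mem_range.2 hn) g hg
      · exact hN n hn g hg x y
    nlinarith [weight_le_two n, one_le_weight n, dist_nonneg (x := g x) (y := g y)]

/-- The weights increase strictly with length. A short word `g` after `f` is a word one letter
longer, whose larger weight yields the gain; a long word contributes at most `a / 2`. -/
theorem exists_wordDist_contraction {F : FunctionSystem X}
    (hF : ∀ σ : ℕ → C(X, X), (∀ n, σ n ∈ F.maps) → ∃ x, ⋂ n, range (compSeq σ n) = {x})
    {a : ℝ} (ha : 0 < a) : ∃ c : ℝ, 0 ≤ c ∧ c < 1 ∧ ∀ f ∈ F.maps, ∀ x y, a ≤ F.wordDist x y →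
      F.wordDist (f x) (f y) ≤ c * F.wordDist x y := by
  obtain ⟨N, hN⟩ := exists_forall_words_dist_lt hF (show 0 < a / 4 by linarith)
  have hpos : (0 : ℝ) < (1 / 2) ^ (N + 2) := by positivity
  have hle : (1 / 2 : ℝ) ^ (N + 2) ≤ 1 / 4 := by
    rw [pow_add]
    have : (1 / 2 : ℝ) ^ N ≤ 1 := pow_le_one₀ (by norm_num) (by norm_num)
    linarith
  -- This factor dominates the ratio of consecutive weights at every `n < N`, and is at least `3 /
  -- 4`, enough for the long words.
  refine ⟨1 - (1 / 2) ^ (N + 2), by linarith, by linarith, fun f hf x y hxy => ?_⟩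
  refine wordDist_le fun n g hg => ?_
  have h0 := dist_nonneg (x := g (f x)) (y := g (f y))
  rcases lt_or_ge n N with hn | hn
  · have h1 := le_wordDist (comp_mem_words hg hf) x y
    have h2 : (2 - (1 / 2 : ℝ) ^ n) ≤ (1 - (1 / 2) ^ (N + 2)) * (2 - (1 / 2) ^ (n + 1)) := by
      have h3 : (1 / 2 : ℝ) ^ N ≤ (1 / 2) ^ n :=
        pow_le_pow_of_le_one (by norm_num) (by norm_num) hn.le
      have h4 : (0 : ℝ) < (1 / 2) ^ N := by positivity
      rw [pow_succ _ n, pow_add _ N 2]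
      nlinarith
    calc _ ≤ (1 - (1 / 2) ^ (N + 2)) * (2 - (1 / 2) ^ (n + 1)) * dist (g (f x)) (g (f y)) :=
          mul_le_mul_of_nonneg_right h2 h0
      _ ≤ _ := by
        rw [mul_assoc]
        exact mul_le_mul_of_nonneg_left h1 (by linarith)
  · have h1 := hN n hn g hg (f x) (f y)
    nlinarith [weight_le_two n, one_le_weight n]

end WordDist

/-- A compact Hausdorff space which is the union of the images of a contracting function system
is metrizable by a metric that makes all maps of the system Rakotch contracting. -/
theorem exists_metric_contraction {K : Type*} [T : TopologicalSpace K] [CompactSpace K] [T2Space K]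
    {F : FunctionSystem K}
    (hF : ∀ σ : ℕ → C(K, K), (∀ n, σ n ∈ F.maps) → ∃ x, ⋂ n, range (compSeq σ n) = {x})
    (hcov : ⋃ f ∈ F.maps, range f = univ) :
    ∃ m : MetricSpace K, m.toUniformSpace.toTopologicalSpace = T ∧
      ∀ a : ℝ, 0 < a → ∃ c : ℝ, 0 ≤ c ∧ c < 1 ∧ ∀ f ∈ F.maps, ∀ x y, a ≤ m.dist x y →
        m.dist (f x) (f y) ≤ c * m.dist x y := by
  have := metrizableSpace_of_contracting hF hcov
  let m₀ : MetricSpace K := metrizableSpaceMetric K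
  exact ⟨MetricSpace.ofDistTopology F.wordDist F.wordDist_self F.wordDist_comm F.wordDist_triangle
    (isOpen_iff_wordDist hF) fun x y h => dist_le_zero.1 (h ▸ F.dist_le_wordDist x y), rfl,
    fun a ha => exists_wordDist_contraction hF ha⟩

end FunctionSystem

/-! ### Rakotch moduli and their iterates. -/

/-- A subadditive modulus of continuity `φ` such that `sup_{t > a} φ(t) / t < 1` for `a > 0`. -/
structure IsRakotchModulus (φ : ℝ → ℝ) : Prop where
  nonneg : ∀ t, 0 ≤ t → 0 ≤ φ t
  mono : ∀ s t, 0 ≤ s → s ≤ t → φ s ≤ φ t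
  zero : φ 0 = 0
  add_le : ∀ s t, 0 ≤ s → 0 ≤ t → φ (s + t) ≤ φ s + φ t
  contr : ∀ a, 0 < a → ∃ c, 0 ≤ c ∧ c < 1 ∧ ∀ t, a < t → φ t ≤ c * t

namespace IsRakotchModulus

variable {φ : ℝ → ℝ} (hφ : IsRakotchModulus φ)
include hφ

theorem le_self {t : ℝ} (ht : 0 ≤ t) : φ t ≤ t := by
  rcases ht.eq_or_lt with rfl | ht
  · exact hφ.zero.le
  · obtain ⟨c, -, hc, h⟩ := hφ.contr (t / 2) (half_pos ht)
    nlinarith [h t (half_lt_self ht)]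

theorem iterate_nonneg {t : ℝ} (ht : 0 ≤ t) (n : ℕ) : 0 ≤ φ^[n] t := by
  induction n with
  | zero => exact ht
  | succ n ih => rw [Function.iterate_succ_apply']; exact hφ.nonneg _ ih

theorem iterate_mono {s t : ℝ} (hs : 0 ≤ s) (hst : s ≤ t) (n : ℕ) : φ^[n] s ≤ φ^[n] t := by
  induction n with
  | zero => exact hst
  | succ n ih =>
    rw [Function.iterate_succ_apply', Function.iterate_succ_apply']
    exact hφ.mono _ _ (hφ.iterate_nonneg hs n) ih

/-- Iterates staying above `ε` would all shrink by the single factor belonging to `ε / 2`, hence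
decay geometrically. -/
theorem tendsto_iterate {t : ℝ} (ht : 0 ≤ t) : Tendsto (fun n => φ^[n] t) atTop (𝓝 0) := by
  have hanti : Antitone fun n => φ^[n] t := antitone_nat_of_succ_le fun n => by
    rw [Function.iterate_succ_apply']
    exact hφ.le_self (hφ.iterate_nonneg ht n)
  rw [Metric.tendsto_atTop]
  intro ε hε
  suffices ∃ N, φ^[N] t < ε by
    obtain ⟨N, hN⟩ := this
    refine ⟨N, fun n hn => ?_⟩
    rw [Real.dist_0_eq_abs, abs_of_nonneg (hφ.iterate_nonneg ht n)]
    exact (hanti hn).trans_lt hN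
  by_contra! hcon
  obtain ⟨c, hc0, hc1, hc⟩ := hφ.contr (ε / 2) (half_pos hε)
  have hpow : ∀ n, φ^[n] t ≤ c ^ n * t := by
    intro n
    induction n with
    | zero => simp
    | succ n ih =>
      rw [Function.iterate_succ_apply', pow_succ']
      calc _ ≤ c * φ^[n] t := hc _ ((half_lt_self hε).trans_le (hcon n))
        _ ≤ _ := by rw [mul_assoc]; exact mul_le_mul_of_nonneg_left ih hc0
  have hlim : Tendsto (fun n => c ^ n * t) atTop (𝓝 (0 * t)) :=
    (tendsto_pow_atTop_nhds_zero_of_lt_one hc0 hc1).mul_const t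
  rw [zero_mul] at hlim
  obtain ⟨n, hn⟩ := (hlim.eventually_lt_const hε).exists
  exact absurd ((hcon n).trans (hpow n)) (not_le.2 hn)

end IsRakotchModulus

/-- A Rakotch-type estimate is dominated by a subadditive modulus. -/
theorem exists_isRakotchModulus {ι : Type*} {s t : ι → ℝ}
    (hst : ∀ i, s i ≤ t i)
    (h : ∀ a : ℝ, 0 < a → ∃ c : ℝ, 0 ≤ c ∧ c < 1 ∧ ∀ i, a ≤ t i → s i ≤ c * t i) :
    ∃ φ, IsRakotchModulus φ ∧ ∀ i, s i ≤ φ (t i) := by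
  choose! c hc0 hc1 hc using h
  -- The line indexed by `a` has slope `c a` and takes the value `a` at `a`: it dominates the
  -- identity on `[0, a]` and `c a * r` everywhere.
  let φ : ℝ → ℝ := fun r => ⨅ a : Ioi (0 : ℝ), (c a * r + (1 - c a) * a)
  have : Nonempty (Ioi (0 : ℝ)) := ⟨⟨1, mem_Ioi.2 one_pos⟩⟩
  have hnn : ∀ r, 0 ≤ r → ∀ a : Ioi (0 : ℝ), 0 ≤ c a * r + (1 - c a) * a := fun r hr a =>
    add_nonneg (mul_nonneg (hc0 a a.2) hr) (mul_nonneg (sub_nonneg.2 (hc1 a a.2).le) (le_of_lt a.2))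
  have hle : ∀ r, 0 ≤ r → ∀ a : ℝ, 0 < a → φ r ≤ c a * r + (1 - c a) * a := fun r hr a ha =>
    ciInf_le ⟨0, by rintro _ ⟨a, rfl⟩; exact hnn r hr a⟩ (⟨a, ha⟩ : Ioi (0 : ℝ))
  have hφ0 : ∀ r, 0 ≤ r → 0 ≤ φ r := fun r hr => by
    exact le_ciInf (hnn r hr)
  -- The intercepts are nonnegative, so `φ r / r` is nonincreasing; adding two such inequalities
  -- yields subadditivity.
  have hmul : ∀ p q, 0 ≤ p → 0 ≤ q → p * φ (p + q) ≤ (p + q) * φ p := by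
    intro p q hp hq
    change _ ≤ (p + q) * ⨅ a : Ioi (0 : ℝ), (c a * p + (1 - c a) * a)
    rw [Real.mul_iInf_of_nonneg (add_nonneg hp hq)]
    refine le_ciInf fun a => ?_
    have h1 := mul_le_mul_of_nonneg_left (hle (p + q) (by positivity) a a.2) hp
    have h2 : 0 ≤ q * ((1 - c a) * a) :=
      mul_nonneg hq (mul_nonneg (sub_nonneg.2 (hc1 a a.2).le) (le_of_lt a.2))
    nlinarith
  refine ⟨φ, ⟨hφ0, ?_, ?_, ?_, ?_⟩, ?_⟩
  · intro p q hp hpq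
    refine le_ciInf fun a => (hle p hp a a.2).trans ?_
    nlinarith [hc0 a a.2]
  · refine le_antisymm (le_of_forall_pos_le_add fun ε hε => ?_) (hφ0 0 le_rfl)
    have := hle 0 le_rfl ε hε
    nlinarith [hc0 ε hε]
  · intro p q hp hq
    rcases (add_nonneg hp hq).eq_or_lt with h0 | hpos
    · obtain ⟨rfl, rfl⟩ : p = 0 ∧ q = 0 := ⟨by linarith, by linarith⟩
      simpa using hφ0 0 le_rfl
    · have h1 := hmul p q hp hq
      have h2 := hmul q p hq hp
      rw [add_comm q p] at h2
      exact le_of_mul_le_mul_left (by linarith) hpos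
  · intro a ha
    have h0 := hc0 (a / 2) (half_pos ha)
    have h1 := hc1 (a / 2) (half_pos ha)
    refine ⟨(1 + c (a / 2)) / 2, by linarith, by linarith, fun r hr => ?_⟩
    have := hle r (by linarith) (a / 2) (half_pos ha)
    nlinarith
  · intro i
    refine le_ciInf fun a => ?_
    have h0 := hc0 a a.2
    have h1 := hc1 a a.2
    have ha : (0 : ℝ) < a := a.2
    rcases le_total (a : ℝ) (t i) with hat | hat
    · have := hc a a.2 i hat
      nlinarith
    · have := hst i
      nlinarith

/-! ### Systems contracting a pseudometric, with values in a compact set. -/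

namespace FunctionSystem

section Contraction

variable {X Y : Type*} [TopologicalSpace X] [MetricSpace Y] {F : FunctionSystem X}
  {E : Set X} {ρ : X → Y} {φ : ℝ → ℝ}

theorem dist_compSeq_le (hφ : IsRakotchModulus φ)
    (hdist : ∀ f ∈ F.maps, ∀ x y, dist (ρ (f x)) (ρ (f y)) ≤ φ (dist (ρ x) (ρ y)))
    {σ : ℕ → C(X, X)} (hσ : ∀ n, σ n ∈ F.maps) (n : ℕ) (x y : X) :
    dist (ρ (compSeq σ n x)) (ρ (compSeq σ n y)) ≤ φ^[n + 1] (dist (ρ x) (ρ y)) := by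
  induction n generalizing x y with
  | zero => exact hdist _ (hσ 0) x y
  | succ n ih =>
    refine (ih (σ (n + 1) x) (σ (n + 1) y)).trans ?_
    rw [Function.iterate_succ_apply (n := n + 1)]
    exact hφ.iterate_mono dist_nonneg (hdist _ (hσ _) x y) _

theorem compSeq_mem {σ : ℕ → C(X, X)} (hmaps : ∀ f ∈ F.maps, ∀ x, f x ∈ E)
    (hσ : ∀ n, σ n ∈ F.maps) (n : ℕ) (x : X) : compSeq σ n x ∈ E := by
  induction n generalizing x with
  | zero => exact hmaps _ (hσ 0) x
  | succ n ih => exact ih _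

/-- A function system mapping `X` into a compact set `E` and contracting with respect to the
pseudometric induced by a map that is injective on `E` is topologically contracting. -/
theorem topologicallyContracting_of_dist [T2Space X] (hE : IsCompact E) (hρ : Continuous ρ)
    (hinj : InjOn ρ E) (hφ : IsRakotchModulus φ) (hmaps : ∀ f ∈ F.maps, ∀ x, f x ∈ E)
    (hdist : ∀ f ∈ F.maps, ∀ x y, dist (ρ (f x)) (ρ (f y)) ≤ φ (dist (ρ x) (ρ y))) :
    F.TopologicallyContracting := by
  constructor
  · intro K
    refine ⟨⟨⟨K ∪ E, K.isCompact.union hE⟩, K.nonempty.inl⟩, subset_union_left, ?_⟩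
    refine iUnion₂_subset fun f hf => ?_
    rintro _ ⟨x, -, rfl⟩
    exact Or.inr (hmaps f hf x)
  · intro D hD σ hσ
    have hanti : ∀ n, compSeq σ (n + 1) '' (D : Set X) ⊆ compSeq σ n '' D := by
      rintro n _ ⟨x, hx, rfl⟩
      exact ⟨σ (n + 1) x, hD (mem_biUnion (hσ (n + 1)) ⟨x, hx, rfl⟩), rfl⟩
    have hcomp : ∀ n, IsCompact (compSeq σ n '' (D : Set X)) := fun n =>
      D.isCompact.image (ContinuousMap.continuous _)
    obtain ⟨x, hx⟩ := IsCompact.nonempty_iInter_of_sequence_nonempty_isCompact_isClosed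
      (fun n => compSeq σ n '' (D : Set X)) hanti (fun n => D.nonempty.image _) (hcomp 0)
      fun n => (hcomp n).isClosed
    refine ⟨x, Subset.antisymm (fun y hy => ?_) (singleton_subset_iff.2 hx)⟩
    have hmem : ∀ z ∈ ⋂ n, compSeq σ n '' (D : Set X), z ∈ E := by
      intro z hz
      obtain ⟨w, -, rfl⟩ := mem_iInter.1 hz 0
      exact compSeq_mem hmaps hσ 0 w
    refine hinj (hmem y hy) (hmem x hx) (dist_le_zero.1 ?_)
    have hbdd := (D.isCompact.image hρ).isBounded
    refine ge_of_tendsto ((hφ.tendsto_iterate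
      (Metric.diam_nonneg (s := ρ '' (D : Set X)))).comp (tendsto_add_atTop_nat 1))
      (Eventually.of_forall fun n => ?_)
    obtain ⟨a, ha, rfl⟩ := mem_iInter.1 hx n
    obtain ⟨b, hb, rfl⟩ := mem_iInter.1 hy n
    exact (dist_compSeq_le hφ hdist hσ n b a).trans (hφ.iterate_mono dist_nonneg
      (Metric.dist_le_diam_of_mem hbdd (mem_image_of_mem ρ hb) (mem_image_of_mem ρ ha)) _)

theorem mem_hutchinson {K : NonemptyCompacts X} {y : X} :
    y ∈ (F.hutchinson K : Set X) ↔ ∃ f ∈ F.maps, ∃ x ∈ K, f x = y := by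
  change y ∈ ⋃ f ∈ F.maps, f '' (K : Set X) ↔ _
  simp

theorem exists_dist_iterate_hutchinson_le (hφ : IsRakotchModulus φ)
    (hdist : ∀ f ∈ F.maps, ∀ x y, dist (ρ (f x)) (ρ (f y)) ≤ φ (dist (ρ x) (ρ y)))
    {K L : NonemptyCompacts X} {r : ℝ} (h : ∀ x ∈ K, ∃ y ∈ L, dist (ρ x) (ρ y) ≤ r) (n : ℕ) :
    ∀ x ∈ F.hutchinson^[n] K, ∃ y ∈ F.hutchinson^[n] L, dist (ρ x) (ρ y) ≤ φ^[n] r := by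
  induction n with
  | zero => exact h
  | succ n ih =>
    simp only [Function.iterate_succ_apply']
    intro x hx
    obtain ⟨f, hf, z, hz, rfl⟩ := mem_hutchinson.1 hx
    obtain ⟨y, hy, hxy⟩ := ih z hz
    exact ⟨f y, mem_hutchinson.2 ⟨f, hf, y, hy, rfl⟩,
      (hdist f hf z y).trans (hφ.mono _ _ dist_nonneg hxy)⟩

/-- On a compact set on which `ρ` is injective, `ρ` is an embedding; this is uniform over
compact subsets. -/
theorem exists_forall_dist_lt_imp_mem (hE : IsCompact E) (hρ : Continuous ρ)
    (hinj : InjOn ρ E) {A U : Set X} (hA : IsCompact A) (hAE : A ⊆ E) (hAU : A ⊆ U)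
    (hU : IsOpen U) : ∃ δ > 0, ∀ a ∈ A, ∀ x ∈ E, dist (ρ x) (ρ a) < δ → x ∈ U := by
  have hdisj : Disjoint (ρ '' A) (ρ '' (E \ U)) := by
    rw [Set.disjoint_left]
    rintro _ ⟨a, ha, rfl⟩ ⟨x, hx, hxa⟩
    exact hx.2 (hinj hx.1 (hAE ha) hxa ▸ hAU ha)
  obtain ⟨δ, hδ, h⟩ := hdisj.exists_thickenings (hA.image hρ) ((hE.diff hU).image hρ).isClosed
  refine ⟨δ, hδ, fun a ha x hx hxa => ?_⟩
  by_contra hxU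
  exact Set.disjoint_left.1 h (Metric.mem_thickening_iff.2 ⟨_, mem_image_of_mem ρ ha, hxa⟩)
    (Metric.self_subset_thickening hδ _ (mem_image_of_mem ρ ⟨hx, hxU⟩))

theorem isAttractor_of_dist (hE : IsCompact E) (hρ : Continuous ρ)
    (hinj : InjOn ρ E) (hφ : IsRakotchModulus φ) (hmaps : ∀ f ∈ F.maps, ∀ x, f x ∈ E)
    (hdist : ∀ f ∈ F.maps, ∀ x y, dist (ρ (f x)) (ρ (f y)) ≤ φ (dist (ρ x) (ρ y)))
    {A : NonemptyCompacts X} (hA : F.hutchinson A = A) : F.IsAttractor A := by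
  refine ⟨hA, fun L => ?_⟩
  have hAn : ∀ n, F.hutchinson^[n] A = A := fun n => Function.iterate_fixed hA n
  have hAE : (A : Set X) ⊆ E := by
    intro a ha
    rw [← hA] at ha
    obtain ⟨f, hf, x, -, rfl⟩ := mem_hutchinson.1 ha
    exact hmaps f hf x
  have hLE : ∀ n ≥ 1, ∀ x ∈ F.hutchinson^[n] L, x ∈ E := by
    intro n hn x hx
    obtain ⟨n, rfl⟩ := Nat.exists_eq_add_of_le' hn
    rw [Function.iterate_succ_apply'] at hx
    obtain ⟨f, hf, x, -, rfl⟩ := mem_hutchinson.1 hx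
    exact hmaps f hf x
  have hbdd := ((A.isCompact.union L.isCompact).image hρ).isBounded
  have hlim := hφ.tendsto_iterate (Metric.diam_nonneg (s := ρ '' (A ∪ L : Set X)))
  obtain ⟨a₀, ha₀⟩ := A.nonempty
  obtain ⟨l₀, hl₀⟩ := L.nonempty
  have hLA := exists_dist_iterate_hutchinson_le hφ hdist (K := L) (L := A) fun x hx =>
    ⟨a₀, ha₀, Metric.dist_le_diam_of_mem hbdd (mem_image_of_mem ρ (Or.inr hx))
      (mem_image_of_mem ρ (Or.inl ha₀))⟩
  have hAL := exists_dist_iterate_hutchinson_le hφ hdist (K := A) (L := L) fun x hx =>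
    ⟨l₀, hl₀, Metric.dist_le_diam_of_mem hbdd (mem_image_of_mem ρ (Or.inl hx))
      (mem_image_of_mem ρ (Or.inr hl₀))⟩
  let _ := TopologicalSpace.vietoris X
  refine NonemptyCompacts.isEmbedding_coe.tendsto_nhds_iff.2
    (tendsto_nhds_generateFrom_iff.2 ?_)
  -- The subbasic neighbourhoods are the sets contained in `U` and the sets meeting `U`. The first
  -- kind needs each point of the iterate to be `ρ`-close to `A`, the second a given point of `A` to
  -- be `ρ`-close to the iterate. From `n = 1` on the iterates lie in `E`, where `ρ`-closeness to
  -- points of `A` gives membership in `U`.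
  rintro _ (⟨U, hU, rfl⟩ | ⟨U, hU, rfl⟩) hAU
  · obtain ⟨δ, hδ, h⟩ := exists_forall_dist_lt_imp_mem hE hρ hinj A.isCompact hAE hAU hU
    filter_upwards [hlim.eventually_lt_const hδ, eventually_ge_atTop 1] with n hn hn1 x hx
    obtain ⟨a, ha, hxa⟩ := hLA n x hx
    rw [hAn] at ha
    exact h a ha x (hLE n hn1 x hx) (hxa.trans_lt hn)
  · obtain ⟨a, ha, haU⟩ := hAU
    obtain ⟨δ, hδ, h⟩ := exists_forall_dist_lt_imp_mem hE hρ hinj (A := {a}) isCompact_singleton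
      (singleton_subset_iff.2 (hAE ha)) (singleton_subset_iff.2 haU) hU
    filter_upwards [hlim.eventually_lt_const hδ, eventually_ge_atTop 1] with n hn hn1
    obtain ⟨x, hx, hax⟩ := hAL n a (by rw [hAn]; exact ha)
    rw [dist_comm] at hax
    exact ⟨x, hx, h a rfl x (hLE n hn1 x hx) (hax.trans_lt hn)⟩

end Contraction

end FunctionSystem

/-! ### McShane extension into a compact set of Lipschitz functions. -/

section Extension

variable {K : Type*} [MetricSpace K] [CompactSpace K]

/-- The Kuratowski embedding of a compact metric space, `k ↦ dist k`. -/
noncomputable def distFun (k : K) : K →ᵇ ℝ :=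
  BoundedContinuousFunction.mkOfCompact ⟨fun y => dist k y, by fun_prop⟩

@[simp] theorem distFun_apply (k y : K) : distFun k y = dist k y := rfl

theorem dist_distFun (k l : K) : dist (distFun k) (distFun l) = dist k l := by
  refine le_antisymm ((BoundedContinuousFunction.dist_le dist_nonneg).2 fun y => ?_) ?_
  · exact dist_dist_dist_le_left k l y
  · simpa [Real.dist_eq] using BoundedContinuousFunction.dist_coe_le_dist
      (f := distFun k) (g := distFun l) l

/-- The `1`-Lipschitz functions with values between `0` and the diameter of the space. -/
def lipFuns (K : Type*) [MetricSpace K] : Set (K →ᵇ ℝ) :=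
  {u | (∀ y z, u y ≤ u z + dist y z) ∧ ∀ y, u y ∈ Icc 0 (Metric.diam (univ : Set K))}

theorem isCompact_lipFuns : IsCompact (lipFuns K) := by
  refine BoundedContinuousFunction.arzela_ascoli₂ (Icc 0 (Metric.diam (univ : Set K)))
    isCompact_Icc _ ?_ (fun u y hu => hu.2 y) ?_
  · have hev : ∀ y : K, Continuous fun u : K →ᵇ ℝ => u y := fun y => by fun_prop
    have heq : lipFuns K = (⋂ y, ⋂ z, {u | u y ≤ u z + dist y z}) ∩
        ⋂ y, {u | u y ∈ Icc 0 (Metric.diam (univ : Set K))} := by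
      ext u
      simp [lipFuns]
    rw [heq]
    exact (isClosed_iInter fun y => isClosed_iInter fun z =>
      isClosed_le (hev y) ((hev z).add continuous_const)).inter
      (isClosed_iInter fun y => isClosed_Icc.preimage (hev y))
  · refine (LipschitzWith.uniformEquicontinuous _ 1 fun u => ?_).equicontinuous
    exact LipschitzWith.of_le_add_mul 1 (by simpa using u.2.1)

theorem distFun_mem_lipFuns (k : K) : distFun k ∈ lipFuns K := by
  refine ⟨fun y z => ?_, fun y => ⟨dist_nonneg, Metric.dist_le_diam_of_mem
    isCompact_univ.isBounded (mem_univ _) (mem_univ _)⟩⟩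
  simpa [dist_comm y z] using dist_triangle k z y

variable {φ : ℝ → ℝ}

/-- The McShane-type infimum extending the map `f` from `K` to all bounded functions on `K`. -/
noncomputable def mcShaneInf (φ : ℝ → ℝ) (f : K → K) (u : K →ᵇ ℝ) (y : K) : ℝ :=
  ⨅ k, (dist (f k) y + φ (dist u (distFun k)))

theorem mcShaneInf_le (hφ : IsRakotchModulus φ) (f : K → K) (u : K →ᵇ ℝ) (y k : K) :
    mcShaneInf φ f u y ≤ dist (f k) y + φ (dist u (distFun k)) :=
  ciInf_le ⟨0, by rintro _ ⟨k, rfl⟩; exact add_nonneg dist_nonneg (hφ.nonneg _ dist_nonneg)⟩ k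

variable [Nonempty K]

theorem mcShaneInf_nonneg (hφ : IsRakotchModulus φ) (f : K → K) (u : K →ᵇ ℝ) (y : K) :
    0 ≤ mcShaneInf φ f u y :=
  le_ciInf fun _ => add_nonneg dist_nonneg (hφ.nonneg _ dist_nonneg)

theorem mcShaneInf_le_add_dist (hφ : IsRakotchModulus φ) (f : K → K) (u : K →ᵇ ℝ) (y z : K) :
    mcShaneInf φ f u y ≤ mcShaneInf φ f u z + dist y z := by
  rw [← sub_le_iff_le_add]
  refine le_ciInf fun k => ?_
  have := mcShaneInf_le hφ f u y k
  have := dist_triangle (f k) z y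
  rw [dist_comm z y] at this
  linarith

/-- Subadditivity of `φ` is what lets the extension keep the same modulus. -/
theorem mcShaneInf_le_add_modulus (hφ : IsRakotchModulus φ) (f : K → K) (u v : K →ᵇ ℝ) (y : K) :
    mcShaneInf φ f u y ≤ mcShaneInf φ f v y + φ (dist u v) := by
  rw [← sub_le_iff_le_add]
  refine le_ciInf fun k => ?_
  have h1 := mcShaneInf_le hφ f u y k
  have h2 := hφ.mono _ _ dist_nonneg (dist_triangle u v (distFun k))
  have h3 := hφ.add_le (dist u v) (dist v (distFun k)) dist_nonneg dist_nonneg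
  linarith

theorem mcShaneInf_distFun (hφ : IsRakotchModulus φ) {f : K → K}
    (hf : ∀ k l, dist (f k) (f l) ≤ φ (dist k l)) (k y : K) :
    mcShaneInf φ f (distFun k) y = dist (f k) y := by
  refine le_antisymm ?_ (le_ciInf fun l => ?_)
  · simpa [hφ.zero] using mcShaneInf_le hφ f (distFun k) y k
  · rw [dist_distFun]
    linarith [hf k l, dist_triangle (f k) (f l) y]

/-- The extension of a self-map of `K` to the bounded continuous functions on `K`. -/
noncomputable def mcShaneExt (hφ : IsRakotchModulus φ) (f : K → K) (u : K →ᵇ ℝ) : K →ᵇ ℝ :=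
  BoundedContinuousFunction.mkOfCompact
    -- Truncation keeps the values in the compact set `lipFuns K`; it leaves distance functions
    -- unchanged.
    ⟨fun y => min (mcShaneInf φ f u y) (Metric.diam (univ : Set K)),
      (LipschitzWith.of_le_add_mul 1 (by
        simpa using mcShaneInf_le_add_dist hφ f u)).continuous.min continuous_const⟩

theorem mcShaneExt_apply (hφ : IsRakotchModulus φ) (f : K → K) (u : K →ᵇ ℝ) (y : K) :
    mcShaneExt hφ f u y = min (mcShaneInf φ f u y) (Metric.diam (univ : Set K)) := rfl

theorem mcShaneExt_mem_lipFuns (hφ : IsRakotchModulus φ) (f : K → K) (u : K →ᵇ ℝ) :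
    mcShaneExt hφ f u ∈ lipFuns K := by
  refine ⟨fun y z => ?_, fun y => ⟨le_min (mcShaneInf_nonneg hφ f u y) Metric.diam_nonneg,
    min_le_right _ _⟩⟩
  rw [mcShaneExt_apply, mcShaneExt_apply, ← min_add_add_right]
  exact min_le_min (mcShaneInf_le_add_dist hφ f u y z) (le_add_of_nonneg_right dist_nonneg)

theorem dist_mcShaneExt_le (hφ : IsRakotchModulus φ) (f : K → K) (u v : K →ᵇ ℝ) :
    dist (mcShaneExt hφ f u) (mcShaneExt hφ f v) ≤ φ (dist u v) := by
  have hle : ∀ (u v : K →ᵇ ℝ) (y : K),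
      mcShaneExt hφ f u y ≤ mcShaneExt hφ f v y + φ (dist u v) := by
    intro u v y
    rw [mcShaneExt_apply, mcShaneExt_apply, ← min_add_add_right]
    exact min_le_min (mcShaneInf_le_add_modulus hφ f u v y)
      (le_add_of_nonneg_right (hφ.nonneg _ dist_nonneg))
  refine (BoundedContinuousFunction.dist_le (hφ.nonneg _ dist_nonneg)).2 fun y => ?_
  rw [Real.dist_eq, abs_sub_le_iff]
  have h1 := hle u v y
  have h2 := hle v u y
  rw [dist_comm v u] at h2
  constructor <;> linarith

theorem mcShaneExt_distFun (hφ : IsRakotchModulus φ) {f : K → K}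
    (hf : ∀ k l, dist (f k) (f l) ≤ φ (dist k l)) (k : K) :
    mcShaneExt hφ f (distFun k) = distFun (f k) := by
  ext y
  rw [mcShaneExt_apply, mcShaneInf_distFun hφ hf, distFun_apply]
  exact min_eq_left (Metric.dist_le_diam_of_mem isCompact_univ.isBounded (mem_univ _) (mem_univ _))

theorem continuous_mcShaneExt (hφ : IsRakotchModulus φ) (f : K → K) :
    Continuous (mcShaneExt hφ f) :=
  (LipschitzWith.of_dist_le_mul (K := 1) fun u v => by
    simpa using (dist_mcShaneExt_le hφ f u v).trans (hφ.le_self dist_nonneg)).continuous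

end Extension

/-! ### Transfer to the universal space. -/

theorem TopologicallyUniversal.exists_isEmbedding {X : Type*} [TopologicalSpace X]
    (hX : TopologicallyUniversal X) (Q : Type*) [TopologicalSpace Q] [CompactSpace Q]
    [MetrizableSpace Q] : ∃ e : Q → X, IsEmbedding e := by
  let _ := metrizableSpaceMetric Q
  -- The range, a subspace of `ℕ →ᵇ ℝ`, replaces `Q` by a homeomorphic space in `Type`.
  obtain ⟨f, hf⟩ := exists_embedding_l_infty Q
  have : CompactSpace (range f) := isCompact_iff_compactSpace.1 (isCompact_range hf.continuous)
  obtain ⟨e, he⟩ := hX (range f)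
  exact ⟨e ∘ hf.toHomeomorph, he.comp hf.toHomeomorph.isEmbedding⟩

/-- A continuous function-valued map on a compact subspace of a Tychonoff space extends to a
bounded continuous function-valued map on the whole space. -/
theorem exists_bounded_extension_of_isEmbedding {X K Q : Type*} [TopologicalSpace X] [T35Space X]
    [TopologicalSpace K] [CompactSpace K] [T2Space K] [TopologicalSpace Q] [CompactSpace Q]
    {e : Q → X} (he : IsEmbedding e) {j : Q → K →ᵇ ℝ} (hj : Continuous j) :
    ∃ ρ : X → K →ᵇ ℝ, Continuous ρ ∧ (∃ C, ∀ x, ‖ρ x‖ ≤ C) ∧ ∀ q, ρ (e q) = j q := by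
  -- Uncurried, `j` is a real function on a closed copy of `Q × K` in a compact Hausdorff, hence
  -- normal, space. Real-valued Tietze applies there, and currying gives `ρ`.
  let i : Q × K → StoneCech X × K := Prod.map (stoneCechUnit ∘ e) id
  have hi : IsEmbedding i := (isEmbedding_stoneCechUnit.comp he).prodMap .id
  have : CompactSpace (Q × K) := inferInstance
  have : T2Space Q := he.t2Space
  have hic : IsClosedEmbedding i := hi.continuous.isClosedEmbedding hi.injective
  let f : C(Q × K, ℝ) := ⟨fun p => j p.1 p.2, by fun_prop⟩
  obtain ⟨g, -, hg⟩ := BoundedContinuousFunction.exists_extension_norm_eq_of_isClosedEmbedding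
    (BoundedContinuousFunction.mkOfCompact f) hic
  refine ⟨fun x => BoundedContinuousFunction.mkOfCompact
    (g.toContinuousMap.curry (stoneCechUnit x)), ?_, ⟨‖g‖, fun x => ?_⟩, fun q => ?_⟩
  · exact (ContinuousMap.linearIsometryBoundedOfCompact K ℝ ℝ).continuous.comp
      ((ContinuousMap.continuous _).comp continuous_stoneCechUnit)
  · exact (BoundedContinuousFunction.norm_le (norm_nonneg g)).2 fun y => g.norm_coe_le_norm _
  · ext y
    exact congrFun hg (q, y)

/-! ### A bounded metric that is isometric to the pullback on `E`. -/

section Metric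

variable {X Y : Type*} [MetricSpace X] [MetricSpace Y]

/-- A distance on `X` which restricts on `E` to the distance pulled back along `ρ`. -/
noncomputable def pullbackDist (E : Set X) (ρ : X → Y) (x y : X) : ℝ :=
  max (dist (ρ x) (ρ y))
    (min 1 (min (dist x y) (Metric.infDist x E + Metric.infDist y E)))

variable {E : Set X} {ρ : X → Y}

theorem pullbackDist_of_mem {x y : X} (hx : x ∈ E) (hy : y ∈ E) :
    pullbackDist E ρ x y = dist (ρ x) (ρ y) := by
  simp [pullbackDist, Metric.infDist_zero_of_mem hx, Metric.infDist_zero_of_mem hy]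

theorem dist_le_pullbackDist (x y : X) : dist (ρ x) (ρ y) ≤ pullbackDist E ρ x y :=
  le_max_left _ _

theorem pullbackDist_self (x : X) : pullbackDist E ρ x x = 0 := by
  have := Metric.infDist_nonneg (x := x) (s := E)
  simp [pullbackDist, this]

theorem pullbackDist_comm (x y : X) : pullbackDist E ρ x y = pullbackDist E ρ y x := by
  simp only [pullbackDist, dist_comm, add_comm]

/-- The second term of the maximum is the truncated pseudometric of `X` with `E` collapsed to a
point; its triangle inequality rests on `infDist` being 1-Lipschitz. -/
theorem pullbackDist_triangle (x y z : X) :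
    pullbackDist E ρ x z ≤ pullbackDist E ρ x y + pullbackDist E ρ y z := by
  have hx := Metric.infDist_nonneg (x := x) (s := E)
  have hy := Metric.infDist_nonneg (x := y) (s := E)
  have hz := Metric.infDist_nonneg (x := z) (s := E)
  have hxy := Metric.infDist_le_infDist_add_dist (x := x) (y := y) (s := E)
  have hzy := Metric.infDist_le_infDist_add_dist (x := z) (y := y) (s := E)
  have h1 := dist_triangle x y z
  have h2 := dist_nonneg (x := x) (y := y)
  have h3 := dist_nonneg (x := y) (y := z)
  rw [dist_comm z y] at hzy
  have key : min 1 (min (dist x z) (Metric.infDist x E + Metric.infDist z E)) ≤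
      min 1 (min (dist x y) (Metric.infDist x E + Metric.infDist y E)) +
      min 1 (min (dist y z) (Metric.infDist y E + Metric.infDist z E)) := by
    simp only [min_def]
    split_ifs <;> linarith
  refine max_le ((dist_triangle _ (ρ y) _).trans ?_) (key.trans ?_)
  · exact add_le_add (le_max_left _ _) (le_max_left _ _)
  · exact add_le_add (le_max_right _ _) (le_max_right _ _)

/-- Off `E` the second term controls the original distance. At `x ∈ E`, a close `y` is near some `e
∈ E`; uniform continuity at `E` makes `ρ e` close to `ρ y`, hence to `ρ x`, and injectivity of `ρ`
on the compact `E` makes `e` close to `x`. -/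
theorem isOpen_iff_pullbackDist (hE : IsCompact E) (hne : E.Nonempty) (hρ : Continuous ρ)
    (hinj : InjOn ρ E) (s : Set X) :
    IsOpen s ↔ ∀ x ∈ s, ∃ ε > 0, ∀ y, pullbackDist E ρ x y < ε → y ∈ s := by
  constructor
  · intro hs x hx
    obtain ⟨r, hr, hball⟩ := Metric.isOpen_iff.1 hs x hx
    by_cases hxE : x ∈ E
    · obtain ⟨δ, hδ, hδU⟩ := FunctionSystem.exists_forall_dist_lt_imp_mem hE hρ hinj (A := {x})
        isCompact_singleton (singleton_subset_iff.2 hxE)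
        (singleton_subset_iff.2 (Metric.mem_ball_self (half_pos hr))) Metric.isOpen_ball
      obtain ⟨η, hη, hηδ⟩ := Metric.mem_uniformity_dist.1
        (hE.uniformContinuousAt_of_continuousAt ρ (fun x _ => hρ.continuousAt)
          (Metric.dist_mem_uniformity (half_pos hδ)))
      refine ⟨min (min 1 (δ / 2)) (min η (r / 2)), by positivity, fun y hy => hball ?_⟩
      have hρxy := ((dist_le_pullbackDist x y).trans_lt hy).trans_le
        ((min_le_left _ _).trans (min_le_right _ _))
      have hinf : Metric.infDist y E < min η (r / 2) := by
        have h1 : min 1 (Metric.infDist y E) ≤ pullbackDist E ρ x y := by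
          refine le_trans (min_le_min le_rfl (le_min ?_ ?_)) (le_max_right _ _)
          · rw [dist_comm]
            exact Metric.infDist_le_dist_of_mem hxE
          · rw [Metric.infDist_zero_of_mem hxE, zero_add]
        rcases min_lt_iff.1 (h1.trans_lt hy) with h | h
        · exact absurd (h.trans_le ((min_le_left _ _).trans (min_le_left _ _))) (lt_irrefl _)
        · exact h.trans_le (min_le_right _ _)
      obtain ⟨e, he, hye⟩ := (Metric.infDist_lt_iff hne).1 hinf
      rw [dist_comm] at hye
      have hρe : dist (ρ e) (ρ y) < δ / 2 := hηδ (hye.trans_le (min_le_left _ _)) he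
      have hex : e ∈ Metric.ball x (r / 2) := hδU x rfl e he (by
        have := dist_triangle_right (ρ e) (ρ x) (ρ y)
        linarith)
      rw [Metric.mem_ball] at hex ⊢
      have := dist_triangle y e x
      rw [dist_comm y e] at this
      have := hye.trans_le (min_le_right _ _)
      linarith
    · have hpos : 0 < Metric.infDist x E := (hE.isClosed.notMem_iff_infDist_pos hne).1 hxE
      refine ⟨min 1 (min r (Metric.infDist x E)), by positivity, fun y hy => hball ?_⟩
      have h := (le_max_right _ _).trans_lt hy
      have hy0 := Metric.infDist_nonneg (x := y) (s := E)
      rw [Metric.mem_ball, dist_comm]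
      by_contra! hcon
      refine absurd h (not_lt.2 (min_le_min le_rfl (le_min ?_ ?_)))
      · exact (min_le_left _ _).trans hcon
      · exact (min_le_right _ _).trans (le_add_of_nonneg_right hy0)
  · intro h
    rw [isOpen_iff_mem_nhds]
    intro x hx
    obtain ⟨ε, hε, hy⟩ := h x hx
    have hc : Continuous fun y => pullbackDist E ρ x y := by
      have := Metric.continuous_infDist_pt E
      unfold pullbackDist
      fun_prop
    have ht := hc.tendsto x
    rw [pullbackDist_self] at ht
    filter_upwards [ht.eventually_lt_const hε] with y hxy using hy y hxy

end Metric

/-- A bounded continuous map on a metrizable space which is injective on a compact set `E`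
becomes nonexpanding, and isometric on `E`, for some bounded compatible metric. -/
theorem exists_bounded_metric_isometric_on {X Y : Type*} [T : TopologicalSpace X]
    [MetrizableSpace X] [MetricSpace Y] {E : Set X} {ρ : X → Y} (hE : IsCompact E)
    (hne : E.Nonempty) (hρ : Continuous ρ) (hinj : InjOn ρ E) {C : ℝ}
    (hC : ∀ x y, dist (ρ x) (ρ y) ≤ C) :
    ∃ m : MetricSpace X, m.toUniformSpace.toTopologicalSpace = T ∧
      (∃ C : ℝ, ∀ x y, m.dist x y ≤ C) ∧ (∀ x y, dist (ρ x) (ρ y) ≤ m.dist x y) ∧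
      ∀ x ∈ E, ∀ y ∈ E, m.dist x y = dist (ρ x) (ρ y) := by
  let m₀ : MetricSpace X := metrizableSpaceMetric X
  have heq : ∀ x y, pullbackDist E ρ x y = 0 → x = y := by
    intro x y h
    by_contra hxy
    -- Separation of points follows from the agreement of topologies.
    obtain ⟨ε, hε, hs⟩ := (isOpen_iff_pullbackDist hE hne hρ hinj {y}ᶜ).1 isOpen_compl_singleton
      x hxy
    exact hs y (h ▸ hε) rfl
  exact ⟨MetricSpace.ofDistTopology (pullbackDist E ρ) pullbackDist_self pullbackDist_comm
    pullbackDist_triangle (isOpen_iff_pullbackDist hE hne hρ hinj) heq, rfl,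
    ⟨max C 1, fun x y => max_le_max (hC x y) (min_le_left _ _)⟩, dist_le_pullbackDist,
    fun x hx y hy => pullbackDist_of_mem hx hy⟩

/-! ### Assembly of the system on the universal space. -/

theorem IsRakotchModulus.rakotchContracting {X Y : Type*} [MetricSpace X] [MetricSpace Y]
    {φ : ℝ → ℝ} (hφ : IsRakotchModulus φ) {f : X → Y}
    (hf : ∀ x y, dist (f x) (f y) ≤ φ (dist x y)) : RakotchContracting f := by
  refine ⟨fun t => (φ t).toNNReal, fun x y => ?_, fun a ha => ?_⟩
  · rw [← NNReal.coe_le_coe, Real.coe_toNNReal _ (hφ.nonneg _ NNReal.zero_le_coe)]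
    exact hf x y
  · obtain ⟨c, hc0, hc1, hc⟩ := hφ.contr a ha
    lift c to ℝ≥0 using hc0
    refine ⟨c, hc1, fun t ht => ?_⟩
    dsimp only
    have ht0 : (0 : ℝ) < t := (NNReal.coe_pos.2 ha).trans (NNReal.coe_lt_coe.2 ht)
    rw [← NNReal.coe_le_coe, NNReal.coe_div, Real.coe_toNNReal _ (hφ.nonneg _ ht0.le),
      div_le_iff₀ ht0]
    exact hc t (NNReal.coe_lt_coe.2 ht)

/-- A topological fractal carries a compatible metric for which the maps of some function system
covering it share a Rakotch modulus. -/
theorem IsTopologicalFractal.exists_metric {K : Type*} [T : TopologicalSpace K]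
    (hK : IsTopologicalFractal K) :
    ∃ (F : FunctionSystem K) (m : MetricSpace K) (φ : ℝ → ℝ),
      m.toUniformSpace.toTopologicalSpace = T ∧ ⋃ f ∈ F.maps, range f = univ ∧
      IsRakotchModulus φ ∧ ∀ f ∈ F.maps, ∀ x y, m.dist (f x) (f y) ≤ φ (m.dist x y) := by
  have := hK.nonempty
  have := hK.compact
  have := hK.hausdorff
  obtain ⟨F, ⟨-, hF⟩, hcov⟩ := hK.exists_system
  have hF' : ∀ σ : ℕ → C(K, K), (∀ n, σ n ∈ F.maps) →
      ∃ x, ⋂ n, range (FunctionSystem.compSeq σ n) = {x} := fun σ hσ => by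
    simpa using hF ⟨⟨univ, isCompact_univ⟩, univ_nonempty⟩ (subset_univ _) σ hσ
  obtain ⟨m, hm, hcontr⟩ := FunctionSystem.exists_metric_contraction hF' hcov
  obtain ⟨φ, hφ, hle⟩ := exists_isRakotchModulus (ι := F.maps × K × K)
    (s := fun i => m.dist (i.1.1 i.2.1) (i.1.1 i.2.2)) (t := fun i => m.dist i.2.1 i.2.2) (by
      rintro ⟨⟨f, hf⟩, x, y⟩
      by_cases hxy : x = y
      · subst hxy
        simp
      -- Taking the scale `a` to be the distance itself shows that the maps are nonexpanding.
      · have hpos : 0 < m.dist x y := @dist_pos K m x y |>.2 hxy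
        obtain ⟨c, -, hc1, hc⟩ := hcontr _ hpos
        exact (hc f hf x y le_rfl).trans (by nlinarith)) (fun a ha => by
      obtain ⟨c, hc0, hc1, hc⟩ := hcontr a ha
      exact ⟨c, hc0, hc1, fun i => hc i.1.1 i.1.2 i.2.1 i.2.2⟩)
  exact ⟨F, m, φ, hm, hcov, hφ, fun f hf x y => hle (⟨f, hf⟩, x, y)⟩

/-- A topological fractal is the attractor of a function system on any universal Tychonoff
space `X`, which contracts a pseudometric on `X` and has values in a compact set. -/
theorem IsTopologicalFractal.exists_contracting_system {X : Type*} [TopologicalSpace X]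
    [T35Space X] (hX : TopologicallyUniversal X) {K : Type*} [T : TopologicalSpace K]
    (hK : IsTopologicalFractal K) :
    ∃ (F : FunctionSystem X) (A : NonemptyCompacts X) (E : Set X) (ρ : X → K →ᵇ ℝ) (φ : ℝ → ℝ),
      F.hutchinson A = A ∧ Nonempty (K ≃ₜ A) ∧ IsCompact E ∧ E.Nonempty ∧ Continuous ρ ∧
      (∃ C, ∀ x y, dist (ρ x) (ρ y) ≤ C) ∧ InjOn ρ E ∧ IsRakotchModulus φ ∧
      (∀ f ∈ F.maps, ∀ x, f x ∈ E) ∧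
      ∀ f ∈ F.maps, ∀ x y, dist (ρ (f x)) (ρ (f y)) ≤ φ (dist (ρ x) (ρ y)) := by
  have := hK.nonempty
  have := hK.compact
  obtain ⟨F, m, φ, rfl, hcov, hφ, hF⟩ := hK.exists_metric
  have : CompactSpace (lipFuns K) := isCompact_iff_compactSpace.1 isCompact_lipFuns
  obtain ⟨e, he⟩ := hX.exists_isEmbedding (lipFuns K)
  obtain ⟨ρ, hρ, ⟨C, hC⟩, hρe⟩ := exists_bounded_extension_of_isEmbedding he
    (continuous_subtype_val (p := (· ∈ lipFuns K)))
  let j : K → lipFuns K := fun k => ⟨distFun k, distFun_mem_lipFuns k⟩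
  have hj : IsEmbedding j :=
    (Isometry.of_dist_eq fun k l => dist_distFun k l : Isometry j).isEmbedding
  let ext : C(K, K) → C(X, X) := fun f =>
    ⟨fun x => e ⟨mcShaneExt hφ f (ρ x), mcShaneExt_mem_lipFuns hφ f _⟩,
      he.continuous.comp (((continuous_mcShaneExt hφ f).comp hρ).subtype_mk _)⟩
  have hext : ∀ f ∈ F.maps, ∀ k, ext f (e (j k)) = e (j (f k)) := by
    intro f hf k
    refine congrArg e (Subtype.ext ?_)
    change mcShaneExt hφ f (ρ (e (j k))) = distFun (f k)
    rw [hρe]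
    exact mcShaneExt_distFun hφ (hF f hf) k
  have hρext : ∀ f x, ρ (ext f x) = mcShaneExt hφ f (ρ x) := fun f x => hρe _
  refine ⟨⟨ext '' F.maps, F.finite.image _, F.nonempty.image _⟩,
    ⟨⟨range (e ∘ j), isCompact_range (he.comp hj).continuous⟩, range_nonempty _⟩, range e, ρ, φ,
    ?_, ⟨(he.comp hj).toHomeomorph⟩, isCompact_range he.continuous, ⟨_, j hK.nonempty.some, rfl⟩,
    hρ, ⟨C + C, fun x y => (dist_le_norm_add_norm _ _).trans (add_le_add (hC x) (hC y))⟩,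
    ?_, hφ, ?_, ?_⟩
  · refine SetLike.coe_injective (Subset.antisymm ?_ ?_)
    · intro y hy
      obtain ⟨_, ⟨f, hf, rfl⟩, _, ⟨k, rfl⟩, rfl⟩ := FunctionSystem.mem_hutchinson.1 hy
      exact ⟨f k, (hext f hf k).symm⟩
    · rintro _ ⟨k, rfl⟩
      have hk : k ∈ ⋃ f ∈ F.maps, range f := hcov ▸ mem_univ k
      simp only [mem_iUnion] at hk
      obtain ⟨f, hf, l, rfl⟩ := hk
      exact FunctionSystem.mem_hutchinson.2 ⟨_, mem_image_of_mem ext hf, _, ⟨l, rfl⟩, hext f hf l⟩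
  · rintro _ ⟨u, rfl⟩ _ ⟨v, rfl⟩ huv
    rw [hρe, hρe] at huv
    rw [Subtype.ext huv]
  · rintro _ ⟨f, -, rfl⟩ x
    exact mem_range_self _
  · rintro _ ⟨f, -, rfl⟩ x y
    rw [hρext, hρext]
    exact dist_mcShaneExt_le hφ f _ _

theorem theorem3 {X : Type*} [TopologicalSpace X] [T35Space X]
    (hX : TopologicallyUniversal X)
    {K : Type*} [TopologicalSpace K] (hK : IsTopologicalFractal K) :
    (∃ (F : FunctionSystem X) (A : NonemptyCompacts X),
      F.TopologicallyContracting ∧ F.IsAttractor A ∧ Nonempty (K ≃ₜ A)) ∧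
    (MetrizableSpace X →
      ∃ (F : FunctionSystem X) (A : NonemptyCompacts X),
        F.TopologicallyContracting ∧ F.IsAttractor A ∧ Nonempty (K ≃ₜ A) ∧
          F.RakotchMetrizable) := by
  obtain ⟨F, A, E, ρ, φ, hA, hKA, hE, hne, hρ, ⟨C, hC⟩, hinj, hφ, hmaps, hdist⟩ :=
    hK.exists_contracting_system hX
  have hcontr : F.TopologicallyContracting :=
    FunctionSystem.topologicallyContracting_of_dist hE hρ hinj hφ hmaps hdist
  have hattr : F.IsAttractor A :=
    FunctionSystem.isAttractor_of_dist hE hρ hinj hφ hmaps hdist hA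
  refine ⟨⟨F, A, hcontr, hattr, hKA⟩, fun hmetr => ⟨F, A, hcontr, hattr, hKA, ?_⟩⟩
  obtain ⟨m, hm, hbdd, hle, hEd⟩ := exists_bounded_metric_isometric_on hE hne hρ hinj hC
  refine ⟨m, hm, hbdd, fun f hf => @IsRakotchModulus.rakotchContracting X X m m φ hφ f
    fun x y => ?_⟩
  -- Equality of the two distances is needed only between image points, which lie in `E`; for the
  -- arguments domination suffices.
  exact (hEd _ (hmaps f hf x) _ (hmaps f hf y)).trans_le
    ((hdist f hf x y).trans (hφ.mono _ _ dist_nonneg (hle x y)))
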